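/- For every integer $m\ge 1$ there is a constant $C>0$ depending only on $m$ such that the following holds. For $\mathbf K=(K_1,\dots,K_m)$ with $K_i>0$ write $B_{\mathbf K}=\{\mathbf x\in\mathbb R^m: -K_i\le x_i\le K_i \text{ for all } i\}$. Let $H\ge 1$ be an integer, let $\mathbf H=(H_1,\dots,H_m)$ be real with $H\le H_i\le 2H$ for all $i$, and let $\mathcal L$ be a full-rank lattice in $\mathbb R^m$ with determinant $\det(\mathcal L)$ (the volume of a fundamental parallelepiped) and dual lattice $\mathcal L^*=\{\mathbf u\in\mathbb R^m:\langle \mathbf u,\mathbf x\rangle\in\mathbb Z \text{ for all }\mathbf x\in\mathcal L\}$. For $1\le i\le m$ let $\lambda_i$ be the $i$-th successive minimum of $B_{\mathbf H}$ with respect to $\mathcal L$, that is, the infimum of all $\lambda>0$ for which $\lambda B_{\mathbf H}$ contains $i$ linearly independent vectors of $\mathcal L$, and let $s$ be the largest $i\in\{1,\dots,m\}$ with $\lambda_i\le 1$ (and $s=0$ if there is no such $i$). Then: (1) For all real $0<H'\le H$ and all $\mathbf H'=(H_1',\dots,H_m')$ with $H'\le H_i'\le 2H'$ for all $i$, $$|B_{\mathbf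 H}\cap\mathcal L|\le C\left(\frac{H}{H'}\right)^{s}|B_{\mathbf H'}\cap\mathcal L|.$$ (2) For all real $a>0$, all real $0<H''\le a/H$ and all $\mathbf H''=(H_1'',\dots,H_m'')$ with $H''\le H_i''\le 2H''$ for all $i$, $$|B_{a/\mathbf H}\cap a\mathcal L^*|\le C\left(\frac{a/H}{H''}\right)^{m-s}|B_{\mathbf H''}\cap a\mathcal L^*|,$$ where $a/\mathbf H=(a/H_1,\dots,a/H_m)$. (3) For all real $a>0$, $$|B_{\mathbf H}\cap\mathcal L|\le C\,\frac{H^m}{\det(\mathcal L)}\,|B_{a/\mathbf H}\cap a\mathcal L^*|\quad\text{and}\quad \frac{H^m}{\det(\mathcal L)}\,|B_{a/\mathbf H}\cap a\mathcal L^*|\le C\,|B_{\mathbf H}\cap\mathcal L|.$$ -/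

import Mathlib

open scoped Pointwise

namespace LatticeBox

/-- The closed box of points `x` with `-H i ≤ x i ≤ H i` for all `i`. -/
def box {m : ℕ} (H : Fin m → ℝ) : Set (Fin m → ℝ) :=
  {x | ∀ i, -H i ≤ x i ∧ x i ≤ H i}

/-- The dual lattice: all `u` with `⟨u, x⟩ ∈ ℤ` for every `x ∈ L`, where `⟨·, ·⟩` is the standard
inner product. -/
def dualLattice {m : ℕ} (L : Submodule ℤ (Fin m → ℝ)) : Submodule ℤ (Fin m → ℝ) where
  carrier := {u | ∀ x ∈ L, ∃ k : ℤ, u ⬝ᵥ x = (k : ℝ)}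
  zero_mem' := fun x _ => ⟨0, by simp⟩
  add_mem' := by
    intro u v hu hv x hx
    obtain ⟨k, hk⟩ := hu x hx
    obtain ⟨l, hl⟩ := hv x hx
    exact ⟨k + l, by rw [add_dotProduct, hk, hl]; push_cast; ring⟩
  smul_mem' := by
    intro c u hu x hx
    obtain ⟨k, hk⟩ := hu x hx
    exact ⟨c * k, by rw [smul_dotProduct, hk]; simp⟩

/-- The `i`-th successive minimum (`1 ≤ i ≤ m`) of `B` with respect to `L`: the infimum of the
`t > 0` for which `t • B` contains `i` linearly independent vectors of `L`. -/
noncomputable def successiveMinimum {m : ℕ} (B : Set (Fin m → ℝ)) (L : Submodule ℤ (Fin m → ℝ))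
    (i : ℕ) : ℝ :=
  sInf {t : ℝ | 0 < t ∧ ∃ v : Fin i → (Fin m → ℝ),
    LinearIndependent ℝ v ∧ ∀ j, v j ∈ L ∧ v j ∈ t • B}

/-- The largest `i` with `1 ≤ i ≤ m` whose successive minimum is at most `1`
(and `0` if there is none). -/
noncomputable def minimaCount {m : ℕ} (B : Set (Fin m → ℝ)) (L : Submodule ℤ (Fin m → ℝ)) : ℕ :=
  sSup {i : ℕ | 1 ≤ i ∧ i ≤ m ∧ successiveMinimum B L i ≤ 1}

theorem minimaCount_le {m : ℕ} (B : Set (Fin m → ℝ)) (L : Submodule ℤ (Fin m → ℝ)) :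
    minimaCount B L ≤ m := by
  rcases Set.eq_empty_or_nonempty {i : ℕ | 1 ≤ i ∧ i ≤ m ∧ successiveMinimum B L i ≤ 1} with h | h
  · simp [minimaCount, h]
  · exact csSup_le h fun i hi => hi.2.1

/-- A box contains only finitely many points of a lattice, so `Set.ncard` is its true count. -/
theorem finite_box_inter {m : ℕ} (H : Fin m → ℝ) (L : Submodule ℤ (Fin m → ℝ))
    [DiscreteTopology L] : (box H ∩ (L : Set (Fin m → ℝ))).Finite := by
  have hb : box H = Set.Icc (-H) H := by
    ext x
    simp only [box, Set.mem_ofPred_eq, Set.mem_Icc, Pi.le_def, Pi.neg_apply]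
    exact forall_and
  have : DiscreteTopology L.toAddSubgroup := inferInstanceAs (DiscreteTopology L)
  have hc : IsClosed (L : Set (Fin m → ℝ)) :=
    AddSubgroup.isClosed_of_discrete (H := L.toAddSubgroup)
  rw [hb]
  exact Metric.finite_isBounded_inter_isClosed (s := (L : Set (Fin m → ℝ)))
    (isDiscrete_iff_discreteTopology.mpr ‹_›) (Metric.isBounded_Icc _ _) hc

end LatticeBox

/-!
The counts of lattice points in boxes are compared directly, without computing them through
Minkowski's second theorem.

*Shrinking a box* (`card_le_of_mem_subspace`). If the lattice points of a box of size `R` lie in a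
subspace of dimension `d`, then that subspace meets the box in a set that is covered by
`O((R / r) ^ d)` cells of diameter `r`, and the differences of lattice points in one cell lie in a
box of size `r`. By the pigeonhole principle the number of lattice points drops by a factor
`O((R / r) ^ d)` at most. For the lattice itself `d` is at most the number `s` of successive minima
not exceeding `1`, because independent lattice points in the box witness small minima
(`boxCount_le_pow_minimaCount`). For the dual lattice the box is first shrunk by a constant factor.
The inner product of a dual vector in the shrunken box and a lattice vector in twice the original
box is then an integer of absolute value less than `1`, hence zero, so the dual vectors lie in a
space of dimension `m - s` (`boxCount_dualLattice_le_pow`).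

*Duality* (`prod_mul_boxCount_dualLattice_le`). The characters of `ℝ^m / L` are indexed by the dual
lattice. The exponential sum over the `N` dual vectors in a small multiple of the reciprocal box has
mean square `N` by orthogonality, and has absolute value at least `N / 2` on half of the original
box. Since this half box covers each point of `ℝ^m / L` at most `boxCount K L` times, its volume
times `N ^ 2 / 4` is at most `boxCount K L * N * covolume L`. This is one of the two inequalities
between the counts in `L` and in its dual. The other one is the same inequality for the dual
lattice, whose covolume is the inverse of that of `L` and whose dual contains `L`.
-/

namespace LatticeBox

open MeasureTheory

/-! ### Counting in subspaces -/

/-- The number of points of `L` in the box with half-sides `K`. It is the true count when `L` is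
discrete, by `finite_box_inter`. -/
noncomputable def boxCount {m : ℕ} (K : Fin m → ℝ) (L : Submodule ℤ (Fin m → ℝ)) : ℕ :=
  (box K ∩ (L : Set (Fin m → ℝ))).ncard

theorem mem_box {m : ℕ} {K x : Fin m → ℝ} : x ∈ box K ↔ ∀ i, |x i| ≤ K i := by
  simp [box, abs_le]

/-- Coordinates on `V` with respect to an orthonormal basis for the standard inner product. The norm
of `Fin m → ℝ` is the sup norm, so the isometry property is stated with sums of squares. -/
theorem exists_orthonormal_coordinates {m : ℕ} (V : Submodule ℝ (Fin m → ℝ)) :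
    ∃ f : V →ₗ[ℝ] (Fin (Module.finrank ℝ V) → ℝ),
      ∀ x : V, ∑ j, f x j ^ 2 = ∑ i, (x : Fin m → ℝ) i ^ 2 := by
  let e := (EuclideanSpace.equiv (Fin m) ℝ).symm.toLinearEquiv
  let W := V.map (e : (Fin m → ℝ) →ₗ[ℝ] EuclideanSpace ℝ (Fin m))
  have hW : Module.finrank ℝ W = Module.finrank ℝ V := (e.submoduleMap V).symm.finrank_eq
  let b := (stdOrthonormalBasis ℝ W).reindex (finCongr hW)
  refine ⟨(EuclideanSpace.equiv _ ℝ).toLinearEquiv.toLinearMap ∘ₗ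
    b.repr.toLinearEquiv.toLinearMap ∘ₗ (e.submoduleMap V).toLinearMap, fun x => ?_⟩
  have h1 := EuclideanSpace.real_norm_sq_eq (b.repr (e.submoduleMap V x))
  have h2 := EuclideanSpace.real_norm_sq_eq (e x)
  rw [LinearIsometryEquiv.norm_map] at h1
  have h3 : ‖e.submoduleMap V x‖ = ‖e x‖ := rfl
  rw [h3, h2] at h1
  exact h1.symm

/-- Equality of Euclidean norms bounds coordinates in one system by those in another. It serves both
to pass from the standard coordinates to orthonormal coordinates of a subspace and to come back. -/
theorem abs_le_mul_of_sum_sq_eq {k n m : ℕ} {a : Fin k → ℝ} {b : Fin n → ℝ} {R : ℝ}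
    (hm : 1 ≤ m) (hR : 0 ≤ R)
    (h : ∑ j, a j ^ 2 = ∑ i, b i ^ 2) (hn : n ≤ m) (hb : ∀ i, |b i| ≤ R) (j : Fin k) :
    |a j| ≤ m * R := by
  have hm0 : (1 : ℝ) ≤ m := by exact_mod_cast hm
  refine abs_le_of_sq_le_sq ?_ (by positivity)
  calc a j ^ 2 ≤ ∑ j, a j ^ 2 := Finset.single_le_sum (f := fun j => a j ^ 2)
        (fun _ _ => sq_nonneg _) (Finset.mem_univ j)
    _ = ∑ i, b i ^ 2 := h
    _ ≤ ∑ _i : Fin n, R ^ 2 := Finset.sum_le_sum fun i _ => sq_le_sq.2 (by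
        rw [abs_of_nonneg hR]; exact hb i)
    _ = n * R ^ 2 := by simp
    _ ≤ m * R ^ 2 := by gcongr
    _ ≤ (m * R) ^ 2 := by nlinarith [sq_nonneg R]

/-- Counting in a large box against a small one, when the points of the large box lie in a subspace
of dimension at most `d`: a grid in orthonormal coordinates of the subspace has `O((R / r) ^ d)`
cells meeting the large box, and subtracting a fixed lattice point of a cell moves all the others
of that cell into the small box. -/
theorem card_le_of_mem_subspace {m : ℕ} (hm : 1 ≤ m) (L : Submodule ℤ (Fin m → ℝ))
    [DiscreteTopology L] (V : Submodule ℝ (Fin m → ℝ)) {d : ℕ} (hd : Module.finrank ℝ V ≤ d)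
    (hdm : d ≤ m) {K K' : Fin m → ℝ} {R r : ℝ} (hr : 0 < r) (hrR : r ≤ R) (hK : ∀ i, K i ≤ R)
    (hK' : ∀ i, r ≤ K' i) (hV : box K ∩ (L : Set (Fin m → ℝ)) ⊆ V) :
    (boxCount K L : ℝ) ≤ (4 * (m : ℝ) ^ 2) ^ m * (R / r) ^ d * boxCount K' L := by
  classical
  obtain ⟨f, hf⟩ := exists_orthonormal_coordinates V
  have hm0 : (1 : ℝ) ≤ m := by exact_mod_cast hm
  have hmpos : (0 : ℝ) < m := by linarith
  have hR : 0 < R := hr.trans_le hrR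
  -- cells of side `r / m` have Euclidean diameter at most `r`
  set δ : ℝ := r / m with hδ
  have hδ0 : 0 < δ := by positivity
  have hdV : Module.finrank ℝ V ≤ m := hd.trans hdm
  set S := (finite_box_inter K L).toFinset with hS
  set T := (finite_box_inter K' L).toFinset with hT
  let F : (Fin m → ℝ) → (Fin (Module.finrank ℝ V) → ℤ) := fun x =>
    if h : x ∈ V then fun j => ⌊f ⟨x, h⟩ j / δ⌋ else 0
  have hSV : ∀ x ∈ S, x ∈ V := fun x hx => hV ((Set.Finite.mem_toFinset _).1 hx)
  set t : ℝ := m ^ 2 * (R / r) with ht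
  have hRr : 1 ≤ R / r := (one_le_div hr).2 hrR
  have ht1 : 1 ≤ t := by
    rw [ht]; nlinarith [one_le_pow₀ (n := 2) hm0]
  -- each coordinate of a point of the box takes at most `4 * t` values
  have himg : S.image F ⊆ Fintype.piFinset fun _ => Finset.Icc ⌊-t⌋ ⌊t⌋ := by
    intro y hy
    obtain ⟨x, hx, rfl⟩ := Finset.mem_image.1 hy
    have hxV := hSV x hx
    have hxK := mem_box.1 ((Set.Finite.mem_toFinset _).1 hx).1
    rw [Fintype.mem_piFinset]
    intro j
    simp only [F, hxV, dif_pos]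
    have h2 := abs_le.1 (abs_le_mul_of_sum_sq_eq hm hR.le (hf ⟨x, hxV⟩) le_rfl
      (fun i => (hxK i).trans (hK i)) j)
    have h3 : t * δ = m * R := by rw [ht, hδ]; field_simp
    rw [Finset.mem_Icc]
    constructor
    · apply Int.floor_le_floor
      rw [le_div_iff₀ hδ0]
      linarith
    · apply Int.floor_le_floor
      rw [div_le_iff₀ hδ0]
      linarith
  have hcard_img : ((S.image F).card : ℝ) ≤ (4 * t) ^ d := by
    have h1 := Finset.card_le_card himg
    rw [Fintype.card_piFinset] at h1
    simp only [Int.card_Icc, Finset.prod_const, Finset.card_univ, Fintype.card_fin] at h1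
    have h2 : (((⌊t⌋ + 1 - ⌊-t⌋).toNat : ℕ) : ℝ) ≤ 4 * t := by
      have h3 : 0 ≤ ⌊t⌋ + 1 - ⌊-t⌋ := by
        have : ⌊-t⌋ ≤ ⌊t⌋ := Int.floor_le_floor (by linarith)
        linarith
      have h4 : (((⌊t⌋ + 1 - ⌊-t⌋).toNat : ℤ) : ℝ) = ((⌊t⌋ + 1 - ⌊-t⌋ : ℤ) : ℝ) := by
        rw [Int.toNat_of_nonneg h3]
      rw [Int.cast_natCast] at h4
      rw [h4]
      push_cast
      linarith [Int.floor_le t, Int.lt_floor_add_one (-t)]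
    calc ((S.image F).card : ℝ) ≤ ((⌊t⌋ + 1 - ⌊-t⌋).toNat : ℝ) ^ Module.finrank ℝ V := by
          exact_mod_cast h1
      _ ≤ (4 * t) ^ Module.finrank ℝ V := by gcongr
      _ ≤ (4 * t) ^ d := pow_le_pow_right₀ (by linarith) hd
  -- differences of points in one cell are lattice points of the small box
  have hfib : ∀ y ∈ S.image F, (S.filter fun x => F x = y).card ≤ T.card := by
    intro y hy
    obtain ⟨x₀, hx₀, rfl⟩ := Finset.mem_image.1 hy
    apply Finset.card_le_card_of_injOn (fun x => x - x₀)
    · intro x hx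
      obtain ⟨hx, hFx⟩ := Finset.mem_filter.1 hx
      have hxV := hSV x hx
      have hx₀V := hSV x₀ hx₀
      have hxL := ((Set.Finite.mem_toFinset _).1 hx).2
      have hx₀L := ((Set.Finite.mem_toFinset _).1 hx₀).2
      simp only [F, hxV, hx₀V, dif_pos] at hFx
      refine (Set.Finite.mem_toFinset _).2 ⟨mem_box.2 fun i => ?_, L.sub_mem hxL hx₀L⟩
      have h1 : ∀ j, |f (⟨x, hxV⟩ - ⟨x₀, hx₀V⟩) j| ≤ δ := by
        intro j
        have h2 := Int.abs_sub_lt_one_of_floor_eq_floor (congrFun hFx j)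
        rw [← sub_div, abs_div, abs_of_pos hδ0, div_lt_one hδ0] at h2
        rw [map_sub, Pi.sub_apply]
        exact h2.le
      have h3 := abs_le_mul_of_sum_sq_eq hm hδ0.le (hf (⟨x, hxV⟩ - ⟨x₀, hx₀V⟩)).symm hdV h1 i
      have h4 : m * δ = r := by rw [hδ]; field_simp
      rw [h4] at h3
      exact h3.trans (hK' i)
    · exact fun _ _ _ _ h => sub_left_injective h
  have hmain := Finset.card_le_mul_card_image_of_maps_to
    (fun x hx => Finset.mem_image_of_mem F hx) T.card hfib
  have hSc : boxCount K L = S.card := Set.ncard_eq_toFinset_card _ _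
  have hTc : boxCount K' L = T.card := Set.ncard_eq_toFinset_card _ _
  rw [hSc, hTc]
  have h4m : (1 : ℝ) ≤ 4 * (m : ℝ) ^ 2 := by nlinarith [one_le_pow₀ (n := 2) hm0]
  calc (S.card : ℝ) ≤ T.card * (S.image F).card := by exact_mod_cast hmain
    _ ≤ T.card * (4 * t) ^ d := by gcongr
    _ = (4 * (m : ℝ) ^ 2) ^ d * (R / r) ^ d * T.card := by rw [ht, ← mul_pow]; ring
    _ ≤ (4 * (m : ℝ) ^ 2) ^ m * (R / r) ^ d * T.card := by gcongr

/-! ### Successive minima and spans -/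

theorem smul_box_subset {m : ℕ} {K : Fin m → ℝ} {t T : ℝ} (ht : 0 < t) (htT : t ≤ T) :
    t • box K ⊆ box fun i => T * K i := by
  rintro _ ⟨x, hx, rfl⟩
  rw [mem_box] at hx ⊢
  intro i
  simp only [Pi.smul_apply, smul_eq_mul, abs_mul, abs_of_pos ht]
  exact mul_le_mul htT (hx i) (abs_nonneg _) (ht.le.trans htT)

/-- The lattice points of `B` span a space of dimension at most the number of successive minima
that do not exceed `1`: a basis chosen among them witnesses that many minima. -/
theorem finrank_span_le_minimaCount {m : ℕ} (B : Set (Fin m → ℝ)) (L : Submodule ℤ (Fin m → ℝ)) :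
    Module.finrank ℝ (Submodule.span ℝ (B ∩ (L : Set (Fin m → ℝ)))) ≤ minimaCount B L := by
  set d := Module.finrank ℝ (Submodule.span ℝ (B ∩ (L : Set (Fin m → ℝ)))) with hd
  rcases Nat.eq_zero_or_pos d with h0 | hpos
  · omega
  have hdm : d ≤ m := by
    simpa using Submodule.finrank_le (Submodule.span ℝ (B ∩ (L : Set (Fin m → ℝ))))
  obtain ⟨b, hbs, -, hb⟩ := Submodule.exists_fun_fin_finrank_span_eq ℝ (B ∩ (L : Set (Fin m → ℝ)))
  refine le_csSup ⟨m, fun i hi => hi.2.1⟩ ⟨hpos, hdm, ?_⟩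
  refine csInf_le ⟨0, fun t ht => ht.1.le⟩ ⟨one_pos, b, hb, fun j => ⟨(hbs j).2, ?_⟩⟩
  rw [one_smul]
  exact (hbs j).1

/-- The infimum defining a successive minimum need not be shown to be attained: doubling the box
provides the vectors, and the factor `2` is harmless in the application. -/
theorem exists_linearIndependent_mem_box {m : ℕ} {K : Fin m → ℝ} (hK : ∀ i, 0 < K i)
    (L : Submodule ℤ (Fin m → ℝ)) [DiscreteTopology L] [IsZLattice ℝ L] :
    ∃ v : Fin (minimaCount (box K) L) → (Fin m → ℝ), LinearIndependent ℝ v ∧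
      ∀ j, v j ∈ L ∧ v j ∈ box fun i => 2 * K i := by
  set s := minimaCount (box K) L with hs
  rcases Nat.eq_zero_or_pos s with h0 | hpos
  · have : IsEmpty (Fin s) := by rw [h0]; infer_instance
    exact ⟨fun _ => 0, linearIndependent_empty_type, fun j => isEmptyElim j⟩
  have hmem : s ∈ {i : ℕ | 1 ≤ i ∧ i ≤ m ∧ successiveMinimum (box K) L i ≤ 1} := by
    apply Nat.sSup_mem
    · by_contra hne
      rw [Set.not_nonempty_iff_eq_empty] at hne
      rw [hs, minimaCount, hne] at hpos
      simp at hpos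
    · exact ⟨m, fun i hi => hi.2.1⟩
  obtain ⟨-, hsm, hle⟩ := hmem
  -- the infimum is over a nonempty set, hence is not the junk value `0`: large dilates of the box contain a basis of the lattice
  have hne : {t : ℝ | 0 < t ∧ ∃ v : Fin s → (Fin m → ℝ),
      LinearIndependent ℝ v ∧ ∀ j, v j ∈ L ∧ v j ∈ t • box K}.Nonempty := by
    let b := (IsZLattice.basis L : Module.Basis (Fin m) ℤ L)
    let b' := b.ofZLatticeBasis ℝ L
    refine ⟨1 + ∑ j, ∑ i, |b' j i| / K i, ?_, fun j => b' (Fin.castLE hsm j), ?_, ?_⟩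
    · have : 0 ≤ ∑ j, ∑ i, |b' j i| / K i :=
        Finset.sum_nonneg fun j _ => Finset.sum_nonneg fun i _ => div_nonneg (abs_nonneg _) (hK i).le
      linarith
    · exact b'.linearIndependent.comp _ (Fin.castLE_injective hsm)
    · intro j
      refine ⟨by simp [b'], ?_⟩
      have hnn : ∀ j i, 0 ≤ |b' j i| / K i := fun j i => div_nonneg (abs_nonneg _) (hK i).le
      have hsum : 0 ≤ ∑ j, ∑ i, |b' j i| / K i :=
        Finset.sum_nonneg fun j _ => Finset.sum_nonneg fun i _ => hnn j i
      rw [Set.mem_smul_set_iff_inv_smul_mem₀ (by linarith), mem_box]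
      intro i
      have h1 : |b' (Fin.castLE hsm j) i| / K i ≤ ∑ j, ∑ i, |b' j i| / K i :=
        (Finset.single_le_sum (f := fun i => |b' (Fin.castLE hsm j) i| / K i)
          (fun i _ => hnn _ i) (Finset.mem_univ i)).trans
        (Finset.single_le_sum (f := fun j => ∑ i, |b' j i| / K i)
          (fun j _ => Finset.sum_nonneg fun i _ => hnn j i) (Finset.mem_univ _))
      rw [div_le_iff₀ (hK i)] at h1
      simp only [Pi.smul_apply, smul_eq_mul, abs_mul, abs_inv]
      rw [abs_of_pos (by linarith : 0 < 1 + ∑ j, ∑ i, |b' j i| / K i),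
        inv_mul_le_iff₀ (by linarith)]
      nlinarith [hK i]
  obtain ⟨t, ⟨ht0, v, hv, hvm⟩, ht2⟩ := exists_lt_of_csInf_lt hne (hle.trans_lt one_lt_two)
  exact ⟨v, hv, fun j => ⟨(hvm j).1, smul_box_subset ht0 ht2.le (hvm j).2⟩⟩

theorem finrank_add_card_le_of_dotProduct_eq_zero {m s : ℕ} {S : Set (Fin m → ℝ)}
    {v : Fin s → (Fin m → ℝ)} (hv : LinearIndependent ℝ v) (h : ∀ u ∈ S, ∀ j, u ⬝ᵥ v j = 0) :
    Module.finrank ℝ (Submodule.span ℝ S) ≤ m - s := by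
  have hle : Submodule.span ℝ S ≤ LinearMap.ker (Matrix.mulVecLin (Matrix.of v)) := by
    rw [Submodule.span_le]
    intro u hu
    rw [SetLike.mem_coe, LinearMap.mem_ker]
    ext j
    simpa [Matrix.mulVec, dotProduct_comm] using h u hu j
  have hrank : (Matrix.of v).rank = s := by
    simpa using LinearIndependent.rank_matrix (M := Matrix.of v) hv
  have := LinearMap.finrank_range_add_finrank_ker (Matrix.mulVecLin (Matrix.of v))
  rw [Matrix.rank] at hrank
  rw [hrank, Module.finrank_fin_fun] at this
  have := Submodule.finrank_mono hle
  omega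

/-! ### The dual lattice -/

/-- Equality holds for full-rank lattices, but this inclusion suffices to use duality twice. -/
theorem le_dualLattice_dualLattice {m : ℕ} (L : Submodule ℤ (Fin m → ℝ)) :
    L ≤ dualLattice (dualLattice L) := by
  intro x hx u hu
  rw [dotProduct_comm]
  exact hu x hx

theorem covolume_span_range_basis {m : ℕ} (L : Submodule ℤ (Fin m → ℝ)) [DiscreteTopology L]
    [IsZLattice ℝ L] (b : Module.Basis (Fin m) ℝ (Fin m → ℝ))
    (hb : L = Submodule.span ℤ (Set.range b)) :
    ZLattice.covolume L = |(Matrix.of b).det| := by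
  subst hb
  rw [ZLattice.covolume_eq_measure_fundamentalDomain _ _ (ZSpan.isAddFundamentalDomain b volume),
    ZSpan.volume_real_fundamentalDomain]

/-- The dual lattice is generated by the dual basis, whose matrix is the inverse transpose of that of
a basis of `L`. -/
theorem exists_dual_basis {m : ℕ} (L : Submodule ℤ (Fin m → ℝ)) [DiscreteTopology L]
    [IsZLattice ℝ L] :
    ∃ b : Module.Basis (Fin m) ℝ (Fin m → ℝ), dualLattice L = Submodule.span ℤ (Set.range b) ∧
      |(Matrix.of b).det| = (ZLattice.covolume L)⁻¹ := by
  let c₀ : Module.Basis (Fin m) ℤ L := IsZLattice.basis L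
  let c := c₀.ofZLatticeBasis ℝ L
  have hcL : Submodule.span ℤ (Set.range c) = L := c₀.ofZLatticeBasis_span ℝ
  have hcov := covolume_span_range_basis L c hcL.symm
  set M : Matrix (Fin m) (Fin m) ℝ := Matrix.of c with hM
  have hdet : IsUnit M.det := by
    rw [isUnit_iff_ne_zero]
    intro h
    rw [h, abs_zero] at hcov
    exact ZLattice.covolume_ne_zero L volume hcov
  set N : Matrix (Fin m) (Fin m) ℝ := (M⁻¹).transpose with hN
  have hNunit : IsUnit N := by
    rw [Matrix.isUnit_iff_isUnit_det, hN, Matrix.det_transpose]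
    exact Matrix.isUnit_nonsing_inv_det _ hdet
  let b : Module.Basis (Fin m) ℝ (Fin m → ℝ) := basisOfLinearIndependentOfCardEqFinrank'
    N.row (Matrix.linearIndependent_rows_of_isUnit hNunit) (by simp)
  have hb : ∀ i, b i = N i := fun i => by simp [b]; rfl
  have hbN : Matrix.of b = N := by ext i j; simp [hb]
  have hbc : ∀ i j, b i ⬝ᵥ c j = if i = j then 1 else 0 := by
    intro i j
    have h1 : (M * M⁻¹) j i = (1 : Matrix (Fin m) (Fin m) ℝ) j i := by
      rw [Matrix.mul_nonsing_inv _ hdet]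
    rw [Matrix.mul_apply, Matrix.one_apply] at h1
    rw [dotProduct_comm, hb]
    simp only [eq_comm (a := i)]
    exact h1
  refine ⟨b, le_antisymm ?_ ?_, ?_⟩
  · intro u hu
    have hu' : ∀ j, ∃ k : ℤ, u ⬝ᵥ c j = k := fun j =>
      hu (c j) (hcL ▸ Submodule.subset_span (Set.mem_range_self j))
    choose k hk using hu'
    have : u = ∑ i, k i • b i := by
      have h0 : ∀ j, (u - ∑ i, k i • b i) ⬝ᵥ c j = 0 := by
        intro j
        simp only [sub_dotProduct, sum_dotProduct, smul_dotProduct, hk, hbc]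
        simp
      have h1 : M.mulVec (u - ∑ i, k i • b i) = 0 := by
        ext j
        rw [Matrix.mulVec, dotProduct_comm]
        exact h0 j
      have h2 := Matrix.mulVec_injective_of_isUnit ((Matrix.isUnit_iff_isUnit_det _).2 hdet)
        (h1.trans (Matrix.mulVec_zero M).symm)
      exact sub_eq_zero.1 h2
    rw [this]
    exact Submodule.sum_mem _ fun i _ => Submodule.smul_mem _ _
      (Submodule.subset_span (Set.mem_range_self i))
  · rw [Submodule.span_le]
    rintro _ ⟨i, rfl⟩ x hx
    rw [← hcL] at hx
    induction hx using Submodule.span_induction with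
    | mem x hx =>
      obtain ⟨j, rfl⟩ := hx
      exact ⟨if i = j then 1 else 0, by rw [hbc]; split_ifs <;> simp⟩
    | zero => exact ⟨0, by simp⟩
    | add x y _ _ hx hy =>
      obtain ⟨k, hk⟩ := hx
      obtain ⟨l, hl⟩ := hy
      exact ⟨k + l, by rw [dotProduct_add, hk, hl]; push_cast; ring⟩
    | smul n x _ hx =>
      obtain ⟨k, hk⟩ := hx
      exact ⟨n * k, by rw [dotProduct_smul, hk]; simp⟩
  · rw [hbN, hN, Matrix.det_transpose, Matrix.det_nonsing_inv, hcov, Ring.inverse_eq_inv', abs_inv]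

instance discreteTopology_dualLattice {m : ℕ} (L : Submodule ℤ (Fin m → ℝ)) [DiscreteTopology L]
    [IsZLattice ℝ L] : DiscreteTopology (dualLattice L) := by
  obtain ⟨b, hb, -⟩ := exists_dual_basis L
  rw [hb]
  infer_instance

instance isZLattice_dualLattice {m : ℕ} (L : Submodule ℤ (Fin m → ℝ)) [DiscreteTopology L]
    [IsZLattice ℝ L] : IsZLattice ℝ (dualLattice L) := by
  obtain ⟨b, hb, -⟩ := exists_dual_basis L
  refine ⟨?_⟩
  rw [hb]
  exact ZSpan.span_top b

theorem covolume_dualLattice {m : ℕ} (L : Submodule ℤ (Fin m → ℝ)) [DiscreteTopology L]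
    [IsZLattice ℝ L] : ZLattice.covolume (dualLattice L) = (ZLattice.covolume L)⁻¹ := by
  obtain ⟨b, hb, hdet⟩ := exists_dual_basis L
  rw [covolume_span_range_basis _ b hb, hdet]

/-! ### Exponential sums over the dual lattice -/

theorem abs_dotProduct_le {m : ℕ} {K K' u x : Fin m → ℝ} {c : ℝ} (hu : u ∈ box K)
    (hx : x ∈ box K') (hc : ∀ i, K i * K' i ≤ c) : |u ⬝ᵥ x| ≤ m * c := by
  rw [mem_box] at hu hx
  calc |u ⬝ᵥ x| ≤ ∑ i, |u i * x i| := Finset.abs_sum_le_sum_abs _ _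
    _ ≤ ∑ _i : Fin m, c := Finset.sum_le_sum fun i _ => by
        rw [abs_mul]
        exact (mul_le_mul (hu i) (hx i) (abs_nonneg _) ((abs_nonneg _).trans (hu i))).trans (hc i)
    _ = m * c := by simp

/-- Nontrivial characters of `ℝ^m / L` have mean zero: a translation by a vector `y` with
`⟨w, y⟩ = 1 / 2` changes the sign of the integrand and preserves the integral. -/
theorem setIntegral_cos_eq_zero {m : ℕ} (L : Submodule ℤ (Fin m → ℝ)) [DiscreteTopology L]
    [IsZLattice ℝ L] {D : Set (Fin m → ℝ)} (hD : IsAddFundamentalDomain L D volume)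
    {w : Fin m → ℝ} (hw : w ∈ dualLattice L) (hw0 : w ≠ 0) :
    ∫ x in D, Real.cos (2 * Real.pi * (w ⬝ᵥ x)) = 0 := by
  have : VAddInvariantMeasure L (Fin m → ℝ) volume :=
    (inferInstance : VAddInvariantMeasure L.toAddSubgroup (Fin m → ℝ) volume)
  have : MeasurableVAdd L (Fin m → ℝ) :=
    (inferInstance : MeasurableVAdd L.toAddSubgroup (Fin m → ℝ))
  have hww : w ⬝ᵥ w ≠ 0 := fun h => hw0 (dotProduct_self_eq_zero.1 h)
  set y : Fin m → ℝ := (2 * (w ⬝ᵥ w))⁻¹ • w with hy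
  have hwy : w ⬝ᵥ y = 1 / 2 := by
    rw [hy, dotProduct_smul, smul_eq_mul]; field_simp
  have hinv : ∀ (g : L) (x : Fin m → ℝ), Real.cos (2 * Real.pi * (w ⬝ᵥ (g +ᵥ x))) =
      Real.cos (2 * Real.pi * (w ⬝ᵥ x)) := by
    intro g x
    obtain ⟨k, hk⟩ := hw g g.2
    rw [Submodule.vadd_def, vadd_eq_add, dotProduct_add, hk, add_comm, mul_add,
      mul_comm (2 * Real.pi) (k : ℝ), Real.cos_add_int_mul_two_pi]
  have h1 := hD.setIntegral_eq (hD.vadd_of_comm y)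
    (f := fun x => Real.cos (2 * Real.pi * (w ⬝ᵥ x))) hinv
  have h2 : ∫ x in y +ᵥ D, Real.cos (2 * Real.pi * (w ⬝ᵥ x)) =
      ∫ x in D, Real.cos (2 * Real.pi * (w ⬝ᵥ (y +ᵥ x))) :=
    (measurePreserving_vadd y (volume : Measure (Fin m → ℝ))).setIntegral_image_emb
      (measurableEmbedding_const_vadd _) _ _
  have h3 : ∀ x : Fin m → ℝ, Real.cos (2 * Real.pi * (w ⬝ᵥ (y +ᵥ x))) =
      -Real.cos (2 * Real.pi * (w ⬝ᵥ x)) := by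
    intro x
    rw [vadd_eq_add, dotProduct_add, hwy, ← Real.cos_add_pi]
    congr 1
    ring
  rw [integral_congr_ae (Filter.Eventually.of_forall h3), integral_neg] at h2
  linarith

theorem sum_sum_cos_sub {ι : Type*} (U : Finset ι) (θ : ι → ℝ) :
    ∑ u ∈ U, ∑ v ∈ U, Real.cos (θ u - θ v) =
      (∑ u ∈ U, Real.cos (θ u)) ^ 2 + (∑ u ∈ U, Real.sin (θ u)) ^ 2 := by
  simp only [Real.cos_sub, Finset.sum_add_distrib, sq, Finset.sum_mul_sum]

/-- Orthogonality of characters: the integrand is the square of the absolute value of the exponential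
sum with frequencies in `U`, by `sum_sum_cos_sub`. -/
theorem setIntegral_sum_sum_cos {m : ℕ} (L : Submodule ℤ (Fin m → ℝ)) [DiscreteTopology L]
    [IsZLattice ℝ L] {D : Set (Fin m → ℝ)} (hD : IsAddFundamentalDomain L D volume)
    (hDfin : volume D ≠ ⊤) (U : Finset (Fin m → ℝ)) (hU : ∀ u ∈ U, u ∈ dualLattice L) :
    IntegrableOn (fun x => ∑ u ∈ U, ∑ v ∈ U,
      Real.cos (2 * Real.pi * (u ⬝ᵥ x) - 2 * Real.pi * (v ⬝ᵥ x))) D ∧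
    ∫ x in D, ∑ u ∈ U, ∑ v ∈ U, Real.cos (2 * Real.pi * (u ⬝ᵥ x) - 2 * Real.pi * (v ⬝ᵥ x)) =
      U.card * ZLattice.covolume L := by
  classical
  have : IsFiniteMeasure (volume.restrict D) := ⟨by simpa using hDfin.lt_top⟩
  have hint : ∀ u v : Fin m → ℝ, Integrable
      (fun x => Real.cos (2 * Real.pi * (u ⬝ᵥ x) - 2 * Real.pi * (v ⬝ᵥ x)))
      (volume.restrict D) := by
    intro u v
    refine Integrable.of_bound (C := 1) (Continuous.aestronglyMeasurable ?_)
      (Filter.Eventually.of_forall fun x => Real.abs_cos_le_one _)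
    simp only [dotProduct]
    fun_prop
  refine ⟨integrable_finsetSum _ fun u _ => integrable_finsetSum _ fun v _ => hint u v, ?_⟩
  rw [integral_finsetSum _ fun u _ => integrable_finsetSum _ fun v _ => hint u v]
  have h : ∀ u ∈ U, ∀ v ∈ U,
      ∫ x in D, Real.cos (2 * Real.pi * (u ⬝ᵥ x) - 2 * Real.pi * (v ⬝ᵥ x)) =
        if u = v then ZLattice.covolume L else 0 := by
    intro u hu v hv
    split_ifs with huv
    · subst huv
      simp [ZLattice.covolume_eq_measure_fundamentalDomain L volume hD, measureReal_def]
    · simp only [← mul_sub, ← sub_dotProduct]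
      exact setIntegral_cos_eq_zero L hD (Submodule.sub_mem _ (hU u hu) (hU v hv))
        (sub_ne_zero.2 huv)
  calc _ = ∑ u ∈ U, ∑ v ∈ U, if u = v then ZLattice.covolume L else 0 := by
        refine Finset.sum_congr rfl fun u hu => ?_
        rw [integral_finsetSum _ fun v _ => hint u v]
        exact Finset.sum_congr rfl fun v hv => h u hu v hv
    _ = _ := by simp

open Classical in
/-- A translate of `L` has at most `boxCount K L` points in the box of half the size, because
differences of such points are points of `L` in the box `K`. -/
theorem tsum_indicator_box_le {m : ℕ} (L : Submodule ℤ (Fin m → ℝ)) [DiscreteTopology L]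
    (K x : Fin m → ℝ) (c : ENNReal) :
    ∑' l : L, (if l +ᵥ x ∈ box (fun i => K i / 2) then c else 0) ≤ boxCount K L * c := by
  set T : Set L := {l | l +ᵥ x ∈ box fun i => K i / 2} with hT
  rcases T.eq_empty_or_nonempty with h0 | ⟨l₀, hl₀⟩
  · have : ∀ l : L, l +ᵥ x ∉ box fun i => K i / 2 := fun l hl => by
      have : l ∈ T := hl
      simp [h0] at this
    simp [this]
  have hmaps : Set.MapsTo (fun l : L => ((l - l₀ : L) : Fin m → ℝ)) T
      (box K ∩ (L : Set (Fin m → ℝ))) := by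
    intro l hl
    refine ⟨mem_box.2 fun i => ?_, (l - l₀).2⟩
    have h1 := mem_box.1 hl i
    have h2 := mem_box.1 hl₀ i
    rw [Submodule.vadd_def, vadd_eq_add, Pi.add_apply, abs_le] at h1 h2
    simp only [Submodule.coe_sub, Pi.sub_apply]
    rw [abs_le]
    constructor <;> linarith
  have hinj : Set.InjOn (fun l : L => ((l - l₀ : L) : Fin m → ℝ)) T := fun a _ b _ hab =>
    sub_left_injective (Subtype.ext hab)
  have hfin : T.Finite := Set.Finite.of_injOn hmaps hinj (finite_box_inter K L)
  have hcard : T.ncard ≤ boxCount K L :=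
    Set.ncard_le_ncard_of_injOn _ hmaps hinj (finite_box_inter K L)
  rw [tsum_eq_sum (s := hfin.toFinset) (fun l hl => by
    rw [if_neg]
    exact fun h => hl (hfin.mem_toFinset.2 h))]
  calc _ ≤ ∑ l ∈ hfin.toFinset, c := Finset.sum_le_sum fun l _ => by split_ifs <;> simp
    _ = T.ncard * c := by rw [Finset.sum_const, Set.ncard_eq_toFinset_card _ hfin, nsmul_eq_mul]
    _ ≤ boxCount K L * c := by gcongr

/-- The inequality behind the duality of counts. Let `g` be the square of the absolute value of the
exponential sum over the `N` dual lattice points of the box with half-sides `1 / (4 * m * K i)`.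
On the box with half-sides `K i / 2` it is at least `N ^ 2 / 4`. Its integral over that box is at
most `boxCount K L` times its integral `N * covolume L` over a fundamental domain, since the box
covers each class modulo `L` at most `boxCount K L` times. -/
theorem prod_mul_boxCount_dualLattice_le {m : ℕ} (hm : 1 ≤ m) (L : Submodule ℤ (Fin m → ℝ))
    [DiscreteTopology L] [IsZLattice ℝ L] {K : Fin m → ℝ} (hK : ∀ i, 0 < K i) :
    (∏ i, K i) * boxCount (fun i => 1 / (4 * m) / K i) (dualLattice L) ≤
      4 * ZLattice.covolume L * boxCount K L := by
  classical
  set U := (finite_box_inter (fun i => 1 / (4 * m) / K i) (dualLattice L)).toFinset with hU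
  have hUmem : ∀ u ∈ U, u ∈ box (fun i => 1 / (4 * m) / K i) ∧ u ∈ dualLattice L := fun u hu => by
    simpa [U] using hu
  have hN : boxCount (fun i => 1 / (4 * m) / K i) (dualLattice L) = U.card :=
    Set.ncard_eq_toFinset_card _ _
  rw [hN]
  rcases Nat.eq_zero_or_pos U.card with h0 | hpos
  · rw [h0]
    have := ZLattice.covolume_pos L volume
    simp only [Nat.cast_zero, mul_zero]
    positivity
  have hmpos : (0 : ℝ) < m := by exact_mod_cast hm
  let b : Module.Basis (Fin m) ℤ L := IsZLattice.basis L
  set D := ZSpan.fundamentalDomain (b.ofZLatticeBasis ℝ)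
  have hD : IsAddFundamentalDomain L D volume := ZLattice.isAddFundamentalDomain b volume
  have hDfin : volume D ≠ ⊤ := (ZSpan.fundamentalDomain_isBounded _).measure_lt_top.ne
  obtain ⟨hgint, hg⟩ := setIntegral_sum_sum_cos L hD hDfin U fun u hu => (hUmem u hu).2
  set g : (Fin m → ℝ) → ℝ := fun x => ∑ u ∈ U, ∑ v ∈ U,
    Real.cos (2 * Real.pi * (u ⬝ᵥ x) - 2 * Real.pi * (v ⬝ᵥ x)) with hgdef
  have hg0 : ∀ x, 0 ≤ g x := fun x => by
    simp only [hgdef, sum_sum_cos_sub U fun u => 2 * Real.pi * (u ⬝ᵥ x)]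
    positivity
  have hginv : ∀ (l : L) x, g (l +ᵥ x) = g x := by
    intro l x
    refine Finset.sum_congr rfl fun u hu => Finset.sum_congr rfl fun v hv => ?_
    obtain ⟨k, hk⟩ := Submodule.sub_mem _ (hUmem u hu).2 (hUmem v hv).2 l l.2
    rw [← mul_sub, ← mul_sub, ← sub_dotProduct, ← sub_dotProduct, Submodule.vadd_def, vadd_eq_add,
      dotProduct_add, hk, add_comm, mul_add, mul_comm (2 * Real.pi) (k : ℝ),
      Real.cos_add_int_mul_two_pi]
  set B := box fun i => K i / 2 with hB
  -- on the half-size box all the phases are at most `π / 4`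
  have hgB : ∀ x ∈ B, (U.card : ℝ) ^ 2 / 4 ≤ g x := by
    intro x hx
    have hcos : ∀ u ∈ U, (1 / 2 : ℝ) ≤ Real.cos (2 * Real.pi * (u ⬝ᵥ x)) := by
      intro u hu
      have h1 : |u ⬝ᵥ x| ≤ m * (1 / (8 * m)) := abs_dotProduct_le (hUmem u hu).1 hx fun i => by
        have := (hK i).ne'
        apply le_of_eq
        field_simp
        norm_num
      have h2 : (m : ℝ) * (1 / (8 * m)) = 1 / 8 := by field_simp
      rw [h2] at h1
      rw [← Real.cos_pi_div_three, ← Real.cos_abs (2 * Real.pi * (u ⬝ᵥ x))]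
      have hpi := Real.pi_pos
      apply Real.cos_le_cos_of_nonneg_of_le_pi (abs_nonneg _) (by linarith)
      rw [abs_mul, abs_of_pos (by positivity)]
      nlinarith
    have hsum : (U.card : ℝ) / 2 ≤ ∑ u ∈ U, Real.cos (2 * Real.pi * (u ⬝ᵥ x)) := by
      have := Finset.card_nsmul_le_sum U _ _ hcos
      rw [nsmul_eq_mul] at this
      linarith
    simp only [hgdef, sum_sum_cos_sub U fun u => 2 * Real.pi * (u ⬝ᵥ x)]
    have hc0 : (0 : ℝ) ≤ U.card := Nat.cast_nonneg _
    nlinarith [sq_nonneg (∑ u ∈ U, Real.sin (2 * Real.pi * (u ⬝ᵥ x)))]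
  have hBIcc : B = Set.Icc (fun i => -(K i / 2)) (fun i => K i / 2) := by
    ext x
    simp only [hB, box, Set.mem_ofPred_eq, Set.mem_Icc, Pi.le_def]
    exact forall_and
  have hBmeas : MeasurableSet B := hBIcc ▸ measurableSet_Icc
  have hBvol : volume B = ENNReal.ofReal (∏ i, K i) := by
    rw [hBIcc, Real.volume_Icc_pi, ENNReal.ofReal_prod_of_nonneg fun i _ => (hK i).le]
    exact Finset.prod_congr rfl fun i _ => by congr 1; ring
  have hcount : Countable L := inferInstance
  have : VAddInvariantMeasure L (Fin m → ℝ) volume :=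
    (inferInstance : VAddInvariantMeasure L.toAddSubgroup (Fin m → ℝ) volume)
  have : MeasurableVAdd L (Fin m → ℝ) :=
    (inferInstance : MeasurableVAdd L.toAddSubgroup (Fin m → ℝ))
  have hgmeas : Measurable g := by
    apply Continuous.measurable
    simp only [hgdef, dotProduct]
    fun_prop
  -- unfold the integral over the box along the lattice translates of the fundamental domain
  have key : ENNReal.ofReal ((U.card : ℝ) ^ 2 / 4) * ENNReal.ofReal (∏ i, K i) ≤
      boxCount K L * ENNReal.ofReal (U.card * ZLattice.covolume L) := by
    calc ENNReal.ofReal ((U.card : ℝ) ^ 2 / 4) * ENNReal.ofReal (∏ i, K i)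
        = ∫⁻ _ in B, ENNReal.ofReal ((U.card : ℝ) ^ 2 / 4) := by rw [setLIntegral_const, hBvol]
      _ ≤ ∫⁻ x in B, ENNReal.ofReal (g x) :=
          setLIntegral_mono' hBmeas fun x hx => ENNReal.ofReal_le_ofReal (hgB x hx)
      _ = ∫⁻ x, if x ∈ B then ENNReal.ofReal (g x) else 0 := by
          rw [← lintegral_indicator hBmeas]
          rfl
      _ = ∑' l : L, ∫⁻ x in D, if l +ᵥ x ∈ B then ENNReal.ofReal (g (l +ᵥ x)) else 0 :=
          hD.lintegral_eq_tsum'' _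
      _ = ∫⁻ x in D, ∑' l : L, if l +ᵥ x ∈ B then ENNReal.ofReal (g x) else 0 := by
          simp only [hginv]
          rw [lintegral_tsum]
          intro l
          refine (Measurable.ite ?_ hgmeas.ennreal_ofReal measurable_const).aemeasurable
          exact measurable_const_vadd l hBmeas
      _ ≤ ∫⁻ x in D, boxCount K L * ENNReal.ofReal (g x) :=
          lintegral_mono fun x => tsum_indicator_box_le L K x _
      _ = boxCount K L * ENNReal.ofReal (∫ x in D, g x) := by
          rw [lintegral_const_mul _ hgmeas.ennreal_ofReal,
            ofReal_integral_eq_lintegral_ofReal hgint (Filter.Eventually.of_forall hg0)]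
      _ = _ := by rw [hg]
  have hcov := ZLattice.covolume_pos L volume
  have hprod : 0 ≤ ∏ i, K i := Finset.prod_nonneg fun i _ => (hK i).le
  rw [← ENNReal.ofReal_mul (by positivity), ← ENNReal.ofReal_natCast (boxCount K L),
    ← ENNReal.ofReal_mul (by positivity), ENNReal.ofReal_le_ofReal_iff (by positivity)] at key
  have hc0 : (0 : ℝ) < U.card := by exact_mod_cast hpos
  refine le_of_mul_le_mul_left ?_ hc0
  linarith

/-! ### Comparison of counts -/

theorem boxCount_mono {m : ℕ} {L L' : Submodule ℤ (Fin m → ℝ)} [DiscreteTopology L']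
    (hL : L ≤ L') (K : Fin m → ℝ) : boxCount K L ≤ boxCount K L' :=
  Set.ncard_le_ncard (Set.inter_subset_inter_right _ hL) (finite_box_inter K L')

theorem ncard_box_inter_smul {m : ℕ} (K : Fin m → ℝ) (L : Submodule ℤ (Fin m → ℝ)) {a : ℝ}
    (ha : 0 < a) :
    (box K ∩ a • (L : Set (Fin m → ℝ))).ncard = boxCount (fun i => K i / a) L := by
  have h : box K ∩ a • (L : Set (Fin m → ℝ)) =
      (fun x => a • x) '' (box (fun i => K i / a) ∩ (L : Set (Fin m → ℝ))) := by
    ext x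
    constructor
    · rintro ⟨hx, y, hy, rfl⟩
      refine ⟨y, ⟨mem_box.2 fun i => ?_, hy⟩, rfl⟩
      have := mem_box.1 hx i
      simp only [Pi.smul_apply, smul_eq_mul, abs_mul, abs_of_pos ha] at this
      rwa [le_div_iff₀' ha]
    · rintro ⟨y, ⟨hy, hyL⟩, rfl⟩
      refine ⟨mem_box.2 fun i => ?_, Set.smul_mem_smul_set hyL⟩
      have := mem_box.1 hy i
      rw [le_div_iff₀' ha] at this
      simpa [abs_mul, abs_of_pos ha] using this
  rw [h, Set.ncard_image_of_injective _ (smul_right_injective _ ha.ne'), boxCount]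

theorem boxCount_le_of_le {m : ℕ} (hm : 1 ≤ m) (L : Submodule ℤ (Fin m → ℝ))
    [DiscreteTopology L] {K K' : Fin m → ℝ} {R r : ℝ} (hr : 0 < r) (hrR : r ≤ R)
    (hK : ∀ i, K i ≤ R) (hK' : ∀ i, r ≤ K' i) :
    (boxCount K L : ℝ) ≤ (4 * (m : ℝ) ^ 2 * (R / r)) ^ m * boxCount K' L := by
  rw [mul_pow]
  exact card_le_of_mem_subspace hm L ⊤ (by simp) le_rfl hr hrR hK hK' (by simp)

theorem boxCount_le_pow_minimaCount {m : ℕ} (hm : 1 ≤ m) (L : Submodule ℤ (Fin m → ℝ))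
    [DiscreteTopology L] {K K' : Fin m → ℝ} {R r : ℝ} (hr : 0 < r) (hrR : r ≤ R)
    (hK : ∀ i, K i ≤ 2 * R) (hK' : ∀ i, r ≤ K' i) :
    (boxCount K L : ℝ) ≤
      (8 * (m : ℝ) ^ 2) ^ m * (R / r) ^ minimaCount (box K) L * boxCount K' L := by
  have hR : 0 < R := hr.trans_le hrR
  have h := card_le_of_mem_subspace hm L (Submodule.span ℝ (box K ∩ (L : Set (Fin m → ℝ))))
    (finrank_span_le_minimaCount _ _) (minimaCount_le _ _) hr (by linarith) hK hK'
    Submodule.subset_span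
  have h2 : (2 : ℝ) ^ minimaCount (box K) L ≤ 2 ^ m :=
    pow_le_pow_right₀ one_le_two (minimaCount_le _ _)
  calc (boxCount K L : ℝ)
      ≤ (4 * (m : ℝ) ^ 2) ^ m * (2 * R / r) ^ minimaCount (box K) L * boxCount K' L := h
    _ = (4 * (m : ℝ) ^ 2) ^ m * 2 ^ minimaCount (box K) L *
          (R / r) ^ minimaCount (box K) L * boxCount K' L := by
        rw [mul_div_assoc, mul_pow]; ring
    _ ≤ (4 * (m : ℝ) ^ 2) ^ m * 2 ^ m * (R / r) ^ minimaCount (box K) L * boxCount K' L := by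
        gcongr
    _ = _ := by rw [← mul_pow]; ring

/-- After shrinking the dual box by a constant factor, its dual lattice points are orthogonal to as
many independent vectors as there are successive minima of `box K` not exceeding `1`, so they lie
in a subspace of the complementary dimension. -/
theorem boxCount_dualLattice_le_pow {m : ℕ} (hm : 1 ≤ m) (L : Submodule ℤ (Fin m → ℝ))
    [DiscreteTopology L] [IsZLattice ℝ L] {H r : ℝ} (hH : 0 < H) {K K' : Fin m → ℝ}
    (hK : ∀ i, H ≤ K i ∧ K i ≤ 2 * H) (hr : 0 < r) (hrH : r ≤ 1 / H) (hK' : ∀ i, r ≤ K' i) :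
    (boxCount (fun i => 1 / K i) (dualLattice L) : ℝ) ≤
      (128 * (m : ℝ) ^ 5) ^ m * (1 / H / r) ^ (m - minimaCount (box K) L) *
        boxCount K' (dualLattice L) := by
  have hm0 : (1 : ℝ) ≤ m := by exact_mod_cast hm
  have hmpos : (0 : ℝ) < m := by linarith
  have hKpos : ∀ i, 0 < K i := fun i => hH.trans_le (hK i).1
  -- small enough for `m * κ * (4 * H) < 1`, the bound on the pairing with vectors of `2 • box K`
  set κ : ℝ := 1 / (8 * m * H) with hκ
  have hκ0 : 0 < κ := by positivity
  have hκH : κ ≤ 1 / H := by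
    rw [hκ]
    apply one_div_le_one_div_of_le hH
    nlinarith
  have h1 := boxCount_le_of_le hm (dualLattice L) (K := fun i => 1 / K i) (K' := fun _ => κ)
    hκ0 hκH (fun i => one_div_le_one_div_of_le hH (hK i).1) fun _ => le_rfl
  have h2 : (4 : ℝ) * (m : ℝ) ^ 2 * (1 / H / κ) = 32 * m ^ 3 := by
    rw [hκ]; field_simp; norm_num
  rw [h2] at h1
  -- the pairing of the two sets of points is integral and less than `1` in absolute value
  obtain ⟨v, hv, hvm⟩ := exists_linearIndependent_mem_box hKpos L
  have horth : ∀ u ∈ box (fun _ => κ) ∩ (dualLattice L : Set (Fin m → ℝ)), ∀ j,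
      u ⬝ᵥ v j = 0 := by
    rintro u ⟨huB, huL⟩ j
    obtain ⟨k, hk⟩ := huL (v j) (hvm j).1
    have h3 : |u ⬝ᵥ v j| ≤ m * (κ * (4 * H)) :=
      abs_dotProduct_le huB (hvm j).2 fun i =>
        mul_le_mul_of_nonneg_left (by linarith [(hK i).2]) hκ0.le
    have h4 : m * (κ * (4 * H)) = 1 / 2 := by
      rw [hκ]; field_simp; norm_num
    rw [h4, hk] at h3
    have h5 : |k| < 1 := by
      have : ((|k| : ℤ) : ℝ) < 1 := by rw [Int.cast_abs]; linarith
      exact_mod_cast this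
    rw [hk, Int.abs_lt_one_iff.1 h5, Int.cast_zero]
  have h3 := card_le_of_mem_subspace hm (dualLattice L)
    (Submodule.span ℝ (box (fun _ => κ) ∩ (dualLattice L : Set (Fin m → ℝ))))
    (finrank_add_card_le_of_dotProduct_eq_zero hv horth) (Nat.sub_le _ _) hr hrH
    (fun _ => hκH) hK' Submodule.subset_span
  calc (boxCount (fun i => 1 / K i) (dualLattice L) : ℝ)
      ≤ (32 * (m : ℝ) ^ 3) ^ m * boxCount (fun _ => κ) (dualLattice L) := h1
    _ ≤ (32 * (m : ℝ) ^ 3) ^ m * ((4 * (m : ℝ) ^ 2) ^ m *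
          (1 / H / r) ^ (m - minimaCount (box K) L) * boxCount K' (dualLattice L)) := by gcongr
    _ = (32 * (m : ℝ) ^ 3 * (4 * (m : ℝ) ^ 2)) ^ m *
          (1 / H / r) ^ (m - minimaCount (box K) L) * boxCount K' (dualLattice L) := by
        rw [mul_pow (32 * (m : ℝ) ^ 3)]; ring
    _ = _ := by congr 3; ring

theorem pow_div_covolume_mul_boxCount_le {m : ℕ} (hm : 1 ≤ m) (L : Submodule ℤ (Fin m → ℝ))
    [DiscreteTopology L] [IsZLattice ℝ L] {H : ℝ} (hH : 0 < H) {K : Fin m → ℝ}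
    (hK : ∀ i, H ≤ K i ∧ K i ≤ 2 * H) :
    H ^ m / ZLattice.covolume L * boxCount (fun i => 1 / K i) (dualLattice L) ≤
      4 * (32 * (m : ℝ) ^ 3) ^ m * boxCount K L := by
  have hm0 : (1 : ℝ) ≤ m := by exact_mod_cast hm
  have hmpos : (0 : ℝ) < m := by linarith
  have hKpos : ∀ i, 0 < K i := fun i => hH.trans_le (hK i).1
  have hcov : 0 < ZLattice.covolume L := ZLattice.covolume_pos L volume
  have h1 := boxCount_le_of_le hm (dualLattice L) (K := fun i => 1 / K i)
    (K' := fun i => 1 / (4 * m) / K i) (R := 1 / H) (r := 1 / (8 * m * H)) (by positivity)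
    (one_div_le_one_div_of_le hH (by nlinarith))
    (fun i => one_div_le_one_div_of_le hH (hK i).1) fun i => by
      rw [div_div]
      exact one_div_le_one_div_of_le (mul_pos (by positivity) (hKpos i))
        (by nlinarith [(hK i).2])
  have h2 : (4 : ℝ) * (m : ℝ) ^ 2 * (1 / H / (1 / (8 * m * H))) = 32 * m ^ 3 := by
    field_simp; norm_num
  rw [h2] at h1
  have h3 := prod_mul_boxCount_dualLattice_le hm L hKpos
  have h4 : H ^ m ≤ ∏ i, K i := by
    calc H ^ m = ∏ _i : Fin m, H := by simp
      _ ≤ ∏ i, K i := Finset.prod_le_prod (fun _ _ => hH.le) fun i _ => (hK i).1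
  rw [div_mul_eq_mul_div, div_le_iff₀ hcov]
  calc H ^ m * (boxCount (fun i => 1 / K i) (dualLattice L) : ℝ)
      ≤ (∏ i, K i) * ((32 * (m : ℝ) ^ 3) ^ m *
          boxCount (fun i => 1 / (4 * m) / K i) (dualLattice L)) :=
        mul_le_mul h4 h1 (by positivity) (Finset.prod_nonneg fun i _ => (hKpos i).le)
    _ = (32 * (m : ℝ) ^ 3) ^ m *
          ((∏ i, K i) * boxCount (fun i => 1 / (4 * m) / K i) (dualLattice L)) := by ring
    _ ≤ (32 * (m : ℝ) ^ 3) ^ m * (4 * ZLattice.covolume L * boxCount K L) := by gcongr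
    _ = _ := by ring

/-- This is `pow_div_covolume_mul_boxCount_le` applied to the dual lattice and the reciprocal box. -/
theorem boxCount_le_pow_div_covolume_mul {m : ℕ} (hm : 1 ≤ m) (L : Submodule ℤ (Fin m → ℝ))
    [DiscreteTopology L] [IsZLattice ℝ L] {H : ℝ} (hH : 0 < H) {K : Fin m → ℝ}
    (hK : ∀ i, H ≤ K i ∧ K i ≤ 2 * H) :
    (boxCount K L : ℝ) ≤ 4 * (64 * (m : ℝ) ^ 3) ^ m *
      (H ^ m / ZLattice.covolume L * boxCount (fun i => 1 / K i) (dualLattice L)) := by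
  have hKpos : ∀ i, 0 < K i := fun i => hH.trans_le (hK i).1
  have hcov : 0 < ZLattice.covolume L := ZLattice.covolume_pos L volume
  -- the reciprocal box lies between `1 / (2 * H)` and twice that
  have h := pow_div_covolume_mul_boxCount_le hm (dualLattice L) (H := 1 / (2 * H))
    (K := fun i => 1 / K i) (by positivity) fun i =>
      ⟨one_div_le_one_div_of_le (hKpos i) (hK i).2, by
        have := one_div_le_one_div_of_le hH (hK i).1
        have h2 : 2 * (1 / (2 * H)) = 1 / H := by field_simp
        rwa [h2]⟩
  simp only [one_div_one_div, covolume_dualLattice, div_inv_eq_mul] at h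
  have h1 : (boxCount K L : ℝ) ≤ boxCount K (dualLattice (dualLattice L)) := by
    exact_mod_cast boxCount_mono (le_dualLattice_dualLattice L) K
  have h2 : (1 / (2 * H)) ^ m * ZLattice.covolume L * boxCount K L ≤
      4 * (32 * (m : ℝ) ^ 3) ^ m * boxCount (fun i => 1 / K i) (dualLattice L) :=
    (mul_le_mul_of_nonneg_left h1 (by positivity)).trans h
  have h3 : (boxCount K L : ℝ) = (2 * H) ^ m / ZLattice.covolume L *
      ((1 / (2 * H)) ^ m * ZLattice.covolume L * boxCount K L) := by
    rw [one_div, inv_pow]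
    field_simp
  rw [h3]
  refine (mul_le_mul_of_nonneg_left h2 (by positivity)).trans (le_of_eq ?_)
  have h4 : (64 * (m : ℝ) ^ 3) ^ m = 2 ^ m * (32 * (m : ℝ) ^ 3) ^ m := by
    rw [← mul_pow]; ring
  rw [h4, mul_pow]
  ring

end LatticeBox

theorem mainTheorem9 (m : ℕ) (hm : 1 ≤ m) :
    ∃ C : ℝ, 0 < C ∧
      ∀ (H : ℕ), 1 ≤ H →
      ∀ (Hv : Fin m → ℝ), (∀ i, (H : ℝ) ≤ Hv i ∧ Hv i ≤ 2 * (H : ℝ)) →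
      ∀ (L : Submodule ℤ (Fin m → ℝ)) [DiscreteTopology L] [IsZLattice ℝ L] (s : ℕ),
        s = LatticeBox.minimaCount (LatticeBox.box Hv) L →
        (∀ (H' : ℝ) (Hv' : Fin m → ℝ), 0 < H' → H' ≤ (H : ℝ) →
          (∀ i, H' ≤ Hv' i ∧ Hv' i ≤ 2 * H') →
          ((LatticeBox.box Hv ∩ (L : Set (Fin m → ℝ))).ncard : ℝ) ≤
            C * ((H : ℝ) / H') ^ s *
              ((LatticeBox.box Hv' ∩ (L : Set (Fin m → ℝ))).ncard : ℝ)) ∧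
        (∀ a : ℝ, 0 < a →
          (∀ (H'' : ℝ) (Hv'' : Fin m → ℝ), 0 < H'' → H'' ≤ a / (H : ℝ) →
            (∀ i, H'' ≤ Hv'' i ∧ Hv'' i ≤ 2 * H'') →
            ((LatticeBox.box (fun i => a / Hv i) ∩
                a • (LatticeBox.dualLattice L : Set (Fin m → ℝ))).ncard : ℝ) ≤
              C * ((a / (H : ℝ)) / H'') ^ (m - s) *
                ((LatticeBox.box Hv'' ∩
                  a • (LatticeBox.dualLattice L : Set (Fin m → ℝ))).ncard : ℝ)) ∧
          ((LatticeBox.box Hv ∩ (L : Set (Fin m → ℝ))).ncard : ℝ) ≤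
            C * ((H : ℝ) ^ m / ZLattice.covolume L *
              ((LatticeBox.box (fun i => a / Hv i) ∩
                a • (LatticeBox.dualLattice L : Set (Fin m → ℝ))).ncard : ℝ)) ∧
          (H : ℝ) ^ m / ZLattice.covolume L *
              ((LatticeBox.box (fun i => a / Hv i) ∩
                a • (LatticeBox.dualLattice L : Set (Fin m → ℝ))).ncard : ℝ) ≤
            C * ((LatticeBox.box Hv ∩ (L : Set (Fin m → ℝ))).ncard : ℝ)) := by
  have hm0 : (1 : ℝ) ≤ m := by exact_mod_cast hm
  have hpow : ∀ (c : ℝ) (k : ℕ), 0 ≤ c → c ≤ 128 → k ≤ 5 →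
      (c * (m : ℝ) ^ k) ^ m ≤ (128 * (m : ℝ) ^ 5) ^ m := fun c k hc hc' hk => by
    gcongr
  have hpos : (0 : ℝ) ≤ (128 * (m : ℝ) ^ 5) ^ m := by positivity
  -- this dominates the constants of all four estimates
  refine ⟨4 * (128 * (m : ℝ) ^ 5) ^ m, by positivity, ?_⟩
  rintro H hH Hv hHv L _ _ s rfl
  have hH0 : (0 : ℝ) < H := by exact_mod_cast hH
  have hcov : 0 < ZLattice.covolume L := ZLattice.covolume_pos L MeasureTheory.volume
  refine ⟨fun H' Hv' hH' hHH' hHv' => ?_, fun a ha => ?_⟩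
  · refine (LatticeBox.boxCount_le_pow_minimaCount hm L hH' hHH' (fun i => (hHv i).2)
      fun i => (hHv' i).1).trans ?_
    rw [LatticeBox.boxCount]
    gcongr ?_ * _ * _
    linarith [hpow 8 2 (by norm_num) (by norm_num) (by norm_num)]
  have hcount : (LatticeBox.box (fun i => a / Hv i) ∩
      a • (LatticeBox.dualLattice L : Set (Fin m → ℝ))).ncard =
      LatticeBox.boxCount (fun i => 1 / Hv i) (LatticeBox.dualLattice L) := by
    rw [LatticeBox.ncard_box_inter_smul _ _ ha]
    congr 1
    ext i
    field_simp
  rw [hcount]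
  refine ⟨fun H'' Hv'' hH'' hHH'' hHv'' => ?_, ?_, ?_⟩
  · rw [LatticeBox.ncard_box_inter_smul _ _ ha]
    have hle : H'' / a ≤ 1 / H := by
      rw [div_le_iff₀ ha]
      exact hHH''.trans_eq (by ring)
    refine (LatticeBox.boxCount_dualLattice_le_pow hm L hH0 hHv (div_pos hH'' ha) hle
      (K' := fun i => Hv'' i / a) fun i => div_le_div_of_nonneg_right (hHv'' i).1 ha.le).trans ?_
    have hq : 1 / (H : ℝ) / (H'' / a) = a / H / H'' := by field_simp
    rw [hq]
    gcongr
    linarith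
  · refine (LatticeBox.boxCount_le_pow_div_covolume_mul hm L hH0 hHv).trans ?_
    gcongr ?_ * _
    linarith [hpow 64 3 (by norm_num) (by norm_num) (by norm_num)]
  · refine (LatticeBox.pow_div_covolume_mul_boxCount_le hm L hH0 hHv).trans ?_
    rw [LatticeBox.boxCount]
    gcongr ?_ * _
    linarith [hpow 32 3 (by norm_num) (by norm_num) (by norm_num)]
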